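/- For $q,k\in\mathbb{N}$ let $J_k(q)=q^k\prod_{p\mid q}(1-p^{-k})$ ($p$ running over the primes dividing $q$) be Jordan's totient function, let $\phi=J_1$ be Euler's totient function, and let $B_k$ denote the Bernoulli numbers. For $q\in\mathbb{N}$, $m_1,m_2,m_3\in\mathbb{N}$ and $a,b,c\in\mathbb{Z}$ put $$V_{\chi_1,\chi_2,q}(m_1,m_2,m_3;a,b,c)=\sum_{\substack{\chi_1,\chi_2\ (\mathrm{mod}\ q)\\ \chi_1(-1)=(-1)^{m_1}\\ \chi_2(-1)=(-1)^{m_2}}}\chi_1(a)\chi_2(b)\overline{\chi_1\chi_2}(c)\,L(m_1,\chi_1)L(m_2,\chi_2)L(m_3,\overline{\chi_1\chi_2}),$$ where $\chi_1,\chi_2$ run over the Dirichlet characters modulo $q$ and $L(s,\chi)$ is the Dirichlet $L$-function (continued analytically). **Corollary 2.6.** Let $q\geq 2$ be an integer. For every odd integer $n\geq 3$, $$V_{\chi_1,\chi_2,q}(1,2,n;1,1,1)=\frac{(-1)^{\frac{n+1}{2}}(2\pi)^{n+3}\phi(q)^2}{8q^{n+3}\,n!}\,(N_1-N_2+N_3),$$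 where $$N_1=-\sum_{j=1}^{\frac{n-1}{2}}\binom{n}{2j}\frac{B_{2j}B_{n+3-2j}J_{2j}(q)}{(n+3-2j)(n+2-2j)},$$ $$N_2=\sum_{j=3}^{n}\binom{n}{j}\frac{B_{n+2-j}}{n+2-j}\sum_{l=2}^{j-1}\binom{j}{l}\frac{B_lB_{j+1-l}J_l(q)}{j+1-l},$$ $$N_3=\frac{nB_2B_{n+1}J_2(q)}{2(n+1)}+\frac{B_{n+3}J_{n+3}(q)}{(n+3)(n+2)(n+1)}.$$ In particular, for $n=3$ and $n=5$, $$V_{\chi_1,\chi_2,q}(1,2,3;1,1,1)=\frac{\pi^6\phi(q)^2}{3780q^6}\bigl(J_6(q)-21J_2(q)\bigr),$$ $$V_{\chi_1,\chi_2,q}(1,2,5;1,1,1)=\frac{\pi^8\phi(q)^2}{37800q^8}\bigl(J_8(q)-7J_4(q)-50J_2(q)\bigr).$$ -/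

import Mathlib

/-- Jordan's totient function `J_k(q) = q ^ k * ∏_{p ∣ q} (1 - 1 / p ^ k)`, where `p` runs over the
prime divisors of `q`. -/
def jordanTotient (k q : ℕ) : ℚ :=
  (q : ℚ) ^ k * ∏ p ∈ q.primeFactors, (1 - 1 / (p : ℚ) ^ k)

open Classical in
/-- The weighted mean value of products of three Dirichlet `L`-functions
`V_{χ₁, χ₂, q}(m₁, m₂, m₃; a, b, c)`: the sum over all pairs of Dirichlet characters `χ₁, χ₂`
modulo `q` with `χ₁(-1) = (-1) ^ m₁` and `χ₂(-1) = (-1) ^ m₂`. Here `star χ` is the complex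
conjugate character, and `LFunction` is the Dirichlet `L`-function continued to the complex
plane (it is needed at `s = 1`). -/
noncomputable def meanValueL (q : ℕ) [NeZero q] (m₁ m₂ m₃ : ℕ) (a b c : ℤ) : ℂ :=
  ∑ χ₁ : DirichletCharacter ℂ q with χ₁ (-1) = (-1) ^ m₁,
    ∑ χ₂ : DirichletCharacter ℂ q with χ₂ (-1) = (-1) ^ m₂,
      χ₁ (a : ZMod q) * χ₂ (b : ZMod q) * (star (χ₁ * χ₂)) (c : ZMod q) *
        DirichletCharacter.LFunction χ₁ (m₁ : ℂ) *
        DirichletCharacter.LFunction χ₂ (m₂ : ℂ) *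
        DirichletCharacter.LFunction (star (χ₁ * χ₂)) (m₃ : ℂ)

/-- The sum `N₁`, for odd `n ≥ 3`. -/
def sumN₁ (q n : ℕ) : ℚ :=
  -∑ j ∈ Finset.Icc 1 ((n - 1) / 2),
    (n.choose (2 * j) : ℚ) *
      (bernoulli (2 * j) * bernoulli (n + 3 - 2 * j) * jordanTotient (2 * j) q /
        (((n : ℚ) + 3 - 2 * j) * ((n : ℚ) + 2 - 2 * j)))

/-- The double sum `N₂`, for odd `n ≥ 3`. -/
def sumN₂ (q n : ℕ) : ℚ :=
  ∑ j ∈ Finset.Icc 3 n,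
    (n.choose j : ℚ) * (bernoulli (n + 2 - j) / ((n : ℚ) + 2 - j)) *
      ∑ l ∈ Finset.Icc 2 (j - 1),
        (j.choose l : ℚ) *
          (bernoulli l * bernoulli (j + 1 - l) * jordanTotient l q / ((j : ℚ) + 1 - l))

/-- The term `N₃`. -/
def sumN₃ (q n : ℕ) : ℚ :=
  (n : ℚ) * bernoulli 2 * bernoulli (n + 1) * jordanTotient 2 q / (2 * ((n : ℚ) + 1)) +
    bernoulli (n + 3) * jordanTotient (n + 3) q /
      (((n : ℚ) + 3) * ((n : ℚ) + 2) * ((n : ℚ) + 1))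

/-! Write c₁(x) = π cot πx and c_m(x) = ∑_k (x+k)^(-m) for m ≥ 2. When χ(-1) = (-1)^m, the value
L(m,χ) is (2q^m)⁻¹ ∑_a χ(a) c_m(a/q) (`LFunction_natCast_eq_sum`); for the opposite parity that sum
vanishes, so the parity conditions can be dropped. Orthogonality then collapses the mean value to
φ(q)²/(8q^(n+3)) times the sum of c₁c₂c_n(c/q) over units c (`meanValueL_eq_sum`). The product is
linearised by c₁c₂ = c₃ (`pi_cot_mul_latticeSum_two`) and by partial fractions for c₃c_n
(`latticeSum_three_mul`), whose coefficients are zeta values. Each c_m sums over the units to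
`intZeta m` times J_m(q) (`sum_units_latticeSum`), and Euler's formula turns zeta values into
Bernoulli numbers. This yields a single sum. It agrees with N₁ - N₂ + N₃ because Euler's convolution
identity for Bernoulli numbers evaluates the inner sum of N₂ (`sumN₂_eq`). -/

/-! ### Lattice sums and their product formula. -/

section LatticeSums

open Complex

/-- The lattice sum `∑ 1 / (x + k) ^ m` over all integers `k`. -/
noncomputable def latticeSum (m : ℕ) (x : ℂ) : ℂ := ∑' k : ℤ, ((x + k)⁻¹) ^ m

/-- The sum `∑ 1 / d ^ m` over all nonzero integers `d` (for `m ≥ 2`). -/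
noncomputable def intZeta (m : ℕ) : ℂ := ∑' d : ℤ, ((d : ℂ)⁻¹) ^ m

lemma summable_latticeSum {m : ℕ} (hm : 2 ≤ m) (x : ℂ) :
    Summable fun k : ℤ ↦ ((x + k)⁻¹) ^ m := by
  have := EisensteinSeries.linear_right_summable x 1 (k := m) (by exact_mod_cast hm)
  simpa [inv_pow] using this

lemma hasSum_latticeSum {m : ℕ} (hm : 2 ≤ m) (x : ℂ) :
    HasSum (fun k : ℤ ↦ ((x + k)⁻¹) ^ m) (latticeSum m x) :=
  (summable_latticeSum hm x).hasSum

lemma hasSum_intZeta {m : ℕ} (hm : 2 ≤ m) :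
    HasSum (fun d : ℤ ↦ ((d : ℂ)⁻¹) ^ m) (intZeta m) := by
  simpa [intZeta, latticeSum] using hasSum_latticeSum hm 0

lemma latticeSum_add_int (m : ℕ) (x : ℂ) (d : ℤ) : latticeSum m (x + d) = latticeSum m x := by
  unfold latticeSum
  rw [← (Equiv.addLeft d).tsum_eq (fun k : ℤ ↦ ((x + k)⁻¹) ^ m)]
  simp [add_assoc]

lemma add_int_ne_zero {x : ℂ} (hx : x ∈ integerComplement) (k : ℤ) : x + k ≠ 0 :=
  integerComplement_add_ne_zero hx k

lemma tendsto_inv_add_natCast (y : ℂ) :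
    Filter.Tendsto (fun n : ℕ ↦ (y + n)⁻¹) Filter.atTop (nhds 0) := by
  refine Filter.tendsto_inv₀_cobounded.comp ?_
  refine (tendsto_const_add_cobounded y).comp ?_
  rw [← tendsto_norm_atTop_iff_cobounded]
  simpa using tendsto_natCast_atTop_atTop (R := ℝ)

lemma tendsto_inv_sub_natCast (y : ℂ) :
    Filter.Tendsto (fun n : ℕ ↦ (y - n)⁻¹) Filter.atTop (nhds 0) := by
  have := (tendsto_inv_add_natCast (-y)).neg
  simp only [neg_zero] at this
  refine this.congr fun n ↦ ?_
  rw [← inv_neg]; congr 1; ring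

lemma summable_inv_sub_inv_add_one {x : ℂ} (hx : x ∈ integerComplement) :
    Summable fun k : ℤ ↦ (x + k)⁻¹ - (x + k + 1)⁻¹ := by
  have h1 : Summable fun k : ℤ ↦ ‖(x + k)⁻¹‖ ^ 2 := by
    simpa using (summable_latticeSum le_rfl x).norm
  have h2 : Summable fun k : ℤ ↦ ‖(x + 1 + k)⁻¹‖ ^ 2 := by
    simpa using (summable_latticeSum le_rfl (x + 1)).norm
  refine Summable.of_norm_bounded (h1.add h2) fun k ↦ ?_
  have e : (x + k)⁻¹ - (x + k + 1)⁻¹ = (x + k)⁻¹ * (x + 1 + k)⁻¹ := by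
    have a1 := add_int_ne_zero hx k
    have a2 : x + k + 1 ≠ 0 := by simpa [add_assoc] using add_int_ne_zero hx (k + 1)
    rw [add_right_comm x 1]
    field_simp
    ring
  rw [e, norm_mul]
  nlinarith [sq_nonneg (‖(x + k)⁻¹‖ - ‖(x + 1 + k)⁻¹‖), sq_nonneg (‖(x + k)⁻¹‖),
    sq_nonneg (‖(x + 1 + k)⁻¹‖)]

lemma hasSum_int_telescope {u : ℤ → ℂ} (hs : Summable fun k : ℤ ↦ u k - u (k + 1))
    (hp : Filter.Tendsto (fun n : ℕ ↦ u n) Filter.atTop (nhds 0))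
    (hn : Filter.Tendsto (fun n : ℕ ↦ u (-n)) Filter.atTop (nhds 0)) :
    HasSum (fun k : ℤ ↦ u k - u (k + 1)) 0 := by
  have h1 : HasSum (fun n : ℕ ↦ u n - u (n + 1)) (u 0) := by
    have hs' : Summable fun n : ℕ ↦ u n - u (n + 1) :=
      hs.comp_injective (i := fun n : ℕ ↦ (n : ℤ)) Nat.cast_injective
    rw [hs'.hasSum_iff_tendsto_nat]
    have := hp.const_sub (u 0)
    rw [sub_zero] at this
    refine this.congr fun n ↦ ?_
    induction n with
    | zero => simp
    | succ n ih => rw [Finset.sum_range_succ, ← ih]; push_cast; ring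
  have h2 : HasSum (fun n : ℕ ↦ u (-(n + 1 : ℤ)) - u (-(n + 1 : ℤ) + 1)) (-u 0) := by
    have hs' : Summable fun n : ℕ ↦ u (-(n + 1 : ℤ)) - u (-(n + 1 : ℤ) + 1) :=
      hs.comp_injective (i := fun n : ℕ ↦ -((n : ℤ) + 1)) fun a b h ↦ by simpa using h
    rw [hs'.hasSum_iff_tendsto_nat]
    have := hn.sub_const (u 0)
    rw [zero_sub] at this
    refine this.congr fun n ↦ ?_
    induction n with
    | zero => simp
    | succ n ih =>
      rw [Finset.sum_range_succ, ← ih, show -((n : ℤ) + 1) + 1 = -n by ring]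
      push_cast
      ring
  have := HasSum.of_nat_of_neg_add_one (f := fun k : ℤ ↦ u k - u (k + 1)) h1 h2
  rwa [add_neg_cancel] at this

lemma hasSum_inv_sub_inv_add_one {x : ℂ} (hx : x ∈ integerComplement) :
    HasSum (fun k : ℤ ↦ (x + k)⁻¹ - (x + (k + 1 : ℤ))⁻¹) 0 := by
  refine hasSum_int_telescope (u := fun k : ℤ ↦ (x + k)⁻¹) ?_ ?_ ?_
  · simpa [add_assoc] using summable_inv_sub_inv_add_one hx
  · simpa using tendsto_inv_add_natCast x
  · simpa [sub_eq_add_neg] using tendsto_inv_sub_natCast x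

/-- Telescoping in steps of one. It disposes of the first-order terms u - v in the partial
fractions, which are summable only as a difference. -/
lemma hasSum_inv_sub_inv_add {x : ℂ} (hx : x ∈ integerComplement) (d : ℤ) :
    HasSum (fun k : ℤ ↦ (x + k)⁻¹ - (x + (k + d : ℤ))⁻¹) 0 := by
  have shift (e : ℤ) : HasSum (fun k : ℤ ↦ (x + (k + e : ℤ))⁻¹ - (x + (k + e + 1 : ℤ))⁻¹) 0 := by
    have := (Equiv.addRight e).hasSum_iff.2 (hasSum_inv_sub_inv_add_one hx)
    simpa only [Function.comp_def, Equiv.coe_addRight] using this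
  induction d with
  | zero => simp
  | succ i ih =>
    have := ih.add (shift i)
    rw [add_zero] at this
    refine this.congr_fun fun k ↦ ?_
    rw [show k + ((i : ℤ) + 1) = k + i + 1 by ring]
    ring
  | pred i ih =>
    have := ih.sub (shift (-i - 1))
    rw [sub_zero] at this
    refine this.congr_fun fun k ↦ ?_
    rw [show k + (-(i : ℤ) - 1) + 1 = k + -i by ring]
    ring

/-- Pairs are indexed by their difference first, so that a double sum can be done at fixed
difference. -/
lemma hasSum_mul_shear {f g : ℤ → ℂ} {a b : ℂ} (hf : HasSum f a) (hg : HasSum g b) :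
    HasSum (fun p : ℤ × ℤ ↦ f p.2 * g (p.2 + p.1)) (a * b) := by
  have hprod : HasSum (fun p : ℤ × ℤ ↦ f p.1 * g p.2) (a * b) :=
    hf.mul hg (summable_mul_of_summable_norm hf.summable.norm hg.summable.norm)
  let σ : ℤ × ℤ ≃ ℤ × ℤ :=
    { toFun := fun p ↦ (p.2, p.2 + p.1)
      invFun := fun p ↦ (p.2 - p.1, p.1)
      left_inv := fun p ↦ by simp
      right_inv := fun p ↦ by simp }
  have := σ.hasSum_iff.2 hprod
  simpa only [Function.comp_def, σ, Equiv.coe_fn_mk] using this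

/-- Partial fractions of `u ^ 3 * v ^ n`, where `e⁻¹ = v⁻¹ - u⁻¹`. -/
lemma cube_mul_pow_partialFractions {u v e : ℂ} (h : u * v = e * (u - v)) {n : ℕ} (hn : 1 ≤ n) :
    u ^ 3 * v ^ n = e ^ n * u ^ 3 - n * e ^ (n + 1) * u ^ 2
      + (n + 1).choose 2 * e ^ (n + 2) * (u - v)
      - ∑ j ∈ Finset.Icc 2 n, (n + 2 - j).choose 2 * e ^ (n + 3 - j) * v ^ j := by
  have h2 : u ^ 2 * v = e * u ^ 2 - e ^ 2 * (u - v) := by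
    linear_combination (u - e) * h
  have h3 : u ^ 3 * v = e * u ^ 3 - e ^ 2 * u ^ 2 + e ^ 3 * (u - v) := by
    linear_combination u * h2 + e ^ 2 * h
  induction n, hn using Nat.le_induction with
  | base => simp [h3]
  | succ n hn ih =>
    -- Multiplying by v shifts the tail by one; the new j = 2 term comes from (u - v) * v.
    have hs : ∑ j ∈ Finset.Icc 2 (n + 1), ((n + 1 + 2 - j).choose 2 : ℂ) * e ^ (n + 1 + 3 - j) * v ^ j
        = (n + 1).choose 2 * e ^ (n + 2) * v ^ 2
          + v * ∑ j ∈ Finset.Icc 2 n, ((n + 2 - j).choose 2 : ℂ) * e ^ (n + 3 - j) * v ^ j := by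
      rw [← Finset.add_sum_Ioc_eq_sum_Icc (by omega), Finset.mul_sum]
      congr 1
      symm
      refine Finset.sum_bij (fun j _ ↦ j + 1) ?_ ?_ ?_ ?_
      · intro j hj; simp at hj ⊢; omega
      · intro a _ b _ hab; simpa using hab
      · intro b hb; simp at hb; exact ⟨b - 1, by simp; omega, by omega⟩
      · intro j hj
        rw [show n + 1 + 2 - (j + 1) = n + 2 - j by omega,
          show n + 1 + 3 - (j + 1) = n + 3 - j by omega]
        ring
    rw [pow_succ v n, ← mul_assoc, ih, hs]
    have hc : ((n + 1 + 1).choose 2 : ℂ) = (n + 1).choose 2 + (n + 1) := by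
      rw [Nat.choose_succ_succ' (n + 1) 1]; push_cast [Nat.choose_one_right]; ring
    rw [hc]
    push_cast
    linear_combination e ^ n * h3 - n * e ^ (n + 1) * h2 + (n + 1).choose 2 * e ^ (n + 2) * h

/-- Product formula for lattice sums. -/
lemma latticeSum_three_mul {x : ℂ} (hx : x ∈ integerComplement) {n : ℕ} (hn : 2 ≤ n) :
    latticeSum 3 x * latticeSum n x = latticeSum (n + 3) x + intZeta n * latticeSum 3 x
      - n * intZeta (n + 1) * latticeSum 2 x
      - ∑ j ∈ Finset.Icc 2 n, (n + 2 - j).choose 2 * intZeta (n + 3 - j) * latticeSum j x := by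
  set u : ℤ → ℂ := fun k ↦ (x + k)⁻¹ with hu
  have hprod : HasSum (fun p : ℤ × ℤ ↦ u p.2 ^ 3 * u (p.2 + p.1) ^ n)
      (latticeSum 3 x * latticeSum n x) :=
    hasSum_mul_shear (f := fun k ↦ u k ^ 3) (g := fun k ↦ u k ^ n)
      (hasSum_latticeSum (by norm_num) x) (hasSum_latticeSum hn x)
  have hshift (d : ℤ) {j : ℕ} (hj : 2 ≤ j) :
      HasSum (fun k : ℤ ↦ u (k + d) ^ j) (latticeSum j x) := by
    have := (Equiv.addRight d).hasSum_iff.2 (hasSum_latticeSum hj x)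
    simpa only [Function.comp_def, Equiv.coe_addRight] using this
  -- The formula is uniform in d: at d = 0 the convention 0⁻¹ = 0 kills every term but the diagonal
  -- one, of exponent n + 3.
  have hin (d : ℤ) : HasSum (fun k : ℤ ↦ u k ^ 3 * u (k + d) ^ n)
      ((if d = 0 then latticeSum (n + 3) x else 0) + ((d : ℂ)⁻¹ ^ n * latticeSum 3 x
        - n * (d : ℂ)⁻¹ ^ (n + 1) * latticeSum 2 x
        - ∑ j ∈ Finset.Icc 2 n, (n + 2 - j).choose 2 * (d : ℂ)⁻¹ ^ (n + 3 - j) * latticeSum j x)) := by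
    rcases eq_or_ne d 0 with rfl | hd
    · have h0 : ∀ j ∈ Finset.Icc 2 n, ((n + 2 - j).choose 2 : ℂ) * ((0 : ℤ) : ℂ)⁻¹ ^ (n + 3 - j)
          * latticeSum j x = 0 := by
        intro j hj
        rw [Finset.mem_Icc] at hj
        simp [show n + 3 - j ≠ 0 by omega]
      rw [Finset.sum_eq_zero h0]
      have hd := hasSum_latticeSum (show 2 ≤ n + 3 by omega) x
      simp only [pow_add _ n 3, mul_comm _ (_ ^ 3)] at hd
      simpa [hu, show n ≠ 0 by omega] using hd
    · simp only [if_neg hd, zero_add]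
      have h1 := (hasSum_latticeSum (show 2 ≤ 3 by norm_num) x).mul_left ((d : ℂ)⁻¹ ^ n)
      have h2 := (hasSum_latticeSum le_rfl x).mul_left ((n : ℂ) * (d : ℂ)⁻¹ ^ (n + 1))
      have h3 := (hasSum_inv_sub_inv_add hx d).mul_left
        (((n + 1).choose 2 : ℂ) * (d : ℂ)⁻¹ ^ (n + 2))
      have h4 : HasSum (fun k ↦ ∑ j ∈ Finset.Icc 2 n,
          ((n + 2 - j).choose 2 : ℂ) * (d : ℂ)⁻¹ ^ (n + 3 - j) * u (k + d) ^ j) _ :=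
        hasSum_sum fun j hj ↦ (hshift d (Finset.mem_Icc.1 hj).1).mul_left
          (((n + 2 - j).choose 2 : ℂ) * (d : ℂ)⁻¹ ^ (n + 3 - j))
      have h5 := ((h1.sub h2).add h3).sub h4
      rw [mul_zero, add_zero] at h5
      refine h5.congr_fun fun k ↦ ?_
      refine cube_mul_pow_partialFractions ?_ (by omega)
      have a1 := add_int_ne_zero hx k
      have a2 := add_int_ne_zero hx (k + d)
      have a3 : (d : ℂ) ≠ 0 := by exact_mod_cast hd
      simp only [hu]
      push_cast at a2 ⊢
      field_simp
      ring
  have hout := hprod.prod_fiberwise hin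
  refine hout.unique ?_
  have k1 := (hasSum_intZeta hn).mul_right (latticeSum 3 x)
  have k2 := ((hasSum_intZeta (show 2 ≤ n + 1 by omega)).mul_left (n : ℂ)).mul_right (latticeSum 2 x)
  have k3 : HasSum (fun d : ℤ ↦ ∑ j ∈ Finset.Icc 2 n,
      ((n + 2 - j).choose 2 : ℂ) * (d : ℂ)⁻¹ ^ (n + 3 - j) * latticeSum j x) _ :=
    hasSum_sum fun j hj ↦ ((hasSum_intZeta (show 2 ≤ n + 3 - j by
      have := (Finset.mem_Icc.1 hj).2; omega)).mul_left
        ((n + 2 - j).choose 2 : ℂ)).mul_right (latticeSum j x)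
  have k0 : HasSum (fun d : ℤ ↦ if d = 0 then latticeSum (n + 3) x else 0)
      (latticeSum (n + 3) x) := hasSum_ite_eq 0 _
  convert k0.add ((k1.sub k2).sub k3) using 1
  ring

lemma intZeta_odd {m : ℕ} (hm : Odd m) : intZeta m = 0 := by
  have h : intZeta m = -intZeta m := by
    conv_lhs => rw [intZeta, ← (Equiv.neg ℤ).tsum_eq]
    rw [intZeta, ← tsum_neg]
    congr 1; ext d
    simp [inv_neg, hm.neg_pow]
  exact self_eq_neg.1 h

lemma intZeta_even {m : ℕ} (hm : Even m) (h2 : 2 ≤ m) : intZeta m = 2 * riemannZeta m := by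
  have hs := hasSum_intZeta h2
  have h := hs.nat_add_neg
  have hz : HasSum (fun n : ℕ ↦ 1 / (n : ℂ) ^ m) (riemannZeta m) := by
    rw [zeta_nat_eq_tsum_of_gt_one (by omega)]
    refine Summable.hasSum ?_
    have := hs.summable.comp_injective (Nat.cast_injective (R := ℤ))
    refine this.congr fun n ↦ by simp
  have h0 := h.unique ((hz.mul_left 2).congr_fun fun n ↦ by
    simp [inv_neg, hm.neg_pow]; ring)
  simpa [show m ≠ 0 by omega] using h0

end LatticeSums

/-! ### The relation c₁c₂ = c₃. -/

section CotangentRelation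

open Complex Filter Topology

lemma tsum_mul_geometric {q : ℂ} (hq : ‖q‖ < 1) :
    ∑' n : ℕ, (n : ℂ) * q ^ n = q / (1 - q) ^ 2 :=
  tsum_coe_mul_geometric_of_norm_lt_one hq

lemma tsum_sq_mul_geometric {q : ℂ} (hq : ‖q‖ < 1) :
    ∑' n : ℕ, (n : ℂ) ^ 2 * q ^ n = q * (1 + q) / (1 - q) ^ 3 := by
  have h1 : (1 : ℂ) - q ≠ 0 := by
    intro h
    rw [← sub_eq_zero.1 h] at hq
    simp at hq
  have h2 := (hasSum_choose_mul_geometric_of_norm_lt_one 2 hq).mul_left 2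
  have h3 := (hasSum_coe_mul_geometric_of_norm_lt_one hq).mul_left 3
  have h4 := (hasSum_geometric_of_norm_lt_one hq).mul_left 2
  have h5 := (h2.sub h3).sub h4
  have h6 : HasSum (fun n : ℕ ↦ (n : ℂ) ^ 2 * q ^ n)
      (2 * (1 / (1 - q) ^ (2 + 1)) - 3 * (q / (1 - q) ^ 2) - 2 * (1 - q)⁻¹) := by
    refine h5.congr_fun fun n ↦ ?_
    rw [Nat.cast_choose_two]
    push_cast
    ring
  rw [h6.tsum_eq]
  field_simp
  ring

/-- Leaving the real axis vertically only enlarges each |x + k|, so the series at ε = 0 dominates.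
-/
lemma tendsto_latticeSum_add_I_mul {m : ℕ} (hm : 2 ≤ m) {x : ℝ}
    (hx : (x : ℂ) ∈ integerComplement) :
    Tendsto (fun ε : ℝ ↦ latticeSum m (x + ε * I)) (𝓝 0) (𝓝 (latticeSum m x)) := by
  refine tendsto_tsum_of_dominated_convergence (summable_latticeSum hm x).norm ?_ ?_
  · intro k
    have h : ContinuousAt (fun ε : ℝ ↦ (((x : ℂ) + ε * I + k)⁻¹) ^ m) 0 := by
      refine ContinuousAt.pow (ContinuousAt.inv₀ (by fun_prop) ?_) m
      simpa using add_int_ne_zero hx k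
    simpa [ContinuousAt] using h
  · refine Eventually.of_forall fun ε k ↦ ?_
    rw [norm_pow, norm_pow]
    refine pow_le_pow_left₀ (norm_nonneg _) ?_ m
    rw [norm_inv, norm_inv]
    refine inv_anti₀ (norm_pos_iff.2 (add_int_ne_zero hx k)) ?_
    have e1 : (x : ℂ) + k = ((x + k : ℝ) : ℂ) := by push_cast; ring
    have e2 : (x : ℂ) + ε * I + k = ((x + k : ℝ) : ℂ) + ε * I := by push_cast; ring
    rw [e1, e2, norm_real, Real.norm_eq_abs]
    refine le_trans (le_of_eq ?_) (abs_re_le_norm _)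
    simp

lemma one_sub_exp_two_pi_ne_zero {x : ℂ} (hx : x ∈ integerComplement) :
    1 - exp (2 * Real.pi * I * x) ≠ 0 := by
  intro h
  obtain ⟨n, hn⟩ := Complex.exp_eq_one_iff.1 (sub_eq_zero.1 h).symm
  refine hx ⟨n, ?_⟩
  have : (2 * Real.pi * I : ℂ) ≠ 0 := two_pi_I_ne_zero
  rw [mul_comm (n : ℂ)] at hn
  exact (mul_left_cancel₀ this hn).symm

/-- The q-expansion is available only in the upper half-plane; its closed form F stays continuous on
|q| = 1 away from q = 1, so ε → 0+ carries it to real x. -/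
lemma latticeSum_eq_of_tsum {k : ℕ} (hk : 1 ≤ k) {F : ℂ → ℂ}
    (hF : ∀ q : ℂ, ‖q‖ < 1 → ∑' n : ℕ, (n : ℂ) ^ k * q ^ n = F q)
    (hc : ∀ q : ℂ, 1 - q ≠ 0 → ContinuousAt F q)
    {x : ℝ} (hx : (x : ℂ) ∈ integerComplement) :
    latticeSum (k + 1) x = (-2 * Real.pi * I) ^ (k + 1) / k.factorial *
      F (exp (2 * Real.pi * I * x)) := by
  have hl := (tendsto_latticeSum_add_I_mul (show 2 ≤ k + 1 by omega) hx).mono_left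
    (nhdsWithin_le_nhds (s := Set.Ioi 0))
  refine tendsto_nhds_unique hl ?_
  have hcont : ContinuousAt (fun ε : ℝ ↦ (-2 * Real.pi * I) ^ (k + 1) / k.factorial *
      F (exp (2 * Real.pi * I * (x + ε * I)))) 0 := by
    refine ContinuousAt.mul continuousAt_const ?_
    refine ContinuousAt.comp (f := fun ε : ℝ ↦ exp (2 * Real.pi * I * (x + ε * I))) ?_
      (by fun_prop)
    refine hc _ ?_
    simpa using one_sub_exp_two_pi_ne_zero hx
  have ht : Tendsto (fun ε : ℝ ↦ (-2 * Real.pi * I) ^ (k + 1) / k.factorial *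
      F (exp (2 * Real.pi * I * (x + ε * I)))) (𝓝[>] 0) (𝓝 ((-2 * Real.pi * I) ^ (k + 1) /
      k.factorial * F (exp (2 * Real.pi * I * x)))) := by
    have := hcont.tendsto.mono_left (nhdsWithin_le_nhds (s := Set.Ioi 0))
    simpa using this
  refine ht.congr' ?_
  filter_upwards [self_mem_nhdsWithin] with ε hε
  have him : 0 < ((x : ℂ) + ε * I).im := by simpa using hε
  have hq : ‖exp (2 * Real.pi * I * (x + ε * I))‖ < 1 := by
    exact UpperHalfPlane.norm_exp_two_pi_I_lt_one ⟨(x : ℂ) + ε * I, him⟩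
  have := EisensteinSeries.qExpansion_identity hk ⟨(x : ℂ) + ε * I, him⟩
  simp only [latticeSum]
  rw [← hF _ hq]
  simpa using this.symm

/-- The relation `c₁ c₂ = c₃` between `π cot (π x)` and the lattice sums. -/
lemma pi_cot_mul_latticeSum_two {x : ℝ} (hx : (x : ℂ) ∈ integerComplement) :
    Real.pi * cot (Real.pi * x) * latticeSum 2 x = latticeSum 3 x := by
  have hne := one_sub_exp_two_pi_ne_zero hx
  have h2 := latticeSum_eq_of_tsum (k := 1) le_rfl (F := fun q ↦ q / (1 - q) ^ 2)
    (fun q hq ↦ by simpa using tsum_mul_geometric hq)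
    (fun q hq ↦ ContinuousAt.div (by fun_prop) (by fun_prop) (pow_ne_zero 2 hq)) hx
  have h3 := latticeSum_eq_of_tsum (k := 2) one_le_two (F := fun q ↦ q * (1 + q) / (1 - q) ^ 3)
    (fun q hq ↦ tsum_sq_mul_geometric hq)
    (fun q hq ↦ ContinuousAt.div (by fun_prop) (by fun_prop) (pow_ne_zero 3 hq)) hx
  norm_num at h2 h3
  rw [h2, h3, cot_pi_eq_exp_ratio]
  -- Both sides are now rational functions of q = exp(2πix).
  generalize exp (2 * Real.pi * I * x) = q at *
  field_simp
  ring_nf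
  simp [I_sq]

end CotangentRelation

/-! ### Values of the even and odd Hurwitz zeta functions at positive integers. -/

section HurwitzValues

open Complex Filter Topology HurwitzZeta

/-- Mean value inequality. Since -s - 1 lies in [-3, -2], the sum of both extreme powers bounds
m^(-s-1) whether m ≤ 1 or m ≥ 1, uniformly in s. -/
lemma abs_rpow_neg_sub_rpow_neg_le {m x y s : ℝ} (hm : 0 < m) (hx : m ≤ x) (hy : m ≤ y)
    (hs : s ∈ Set.Icc 1 2) :
    |x ^ (-s) - y ^ (-s)| ≤ 2 * ((m ^ 2)⁻¹ + (m ^ 3)⁻¹) * |x - y| := by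
  have h := (convex_Ici m).norm_image_sub_le_of_norm_hasDerivWithin_le
    (f := fun t : ℝ ↦ t ^ (-s)) (f' := fun t ↦ -s * t ^ (-s - 1))
    (C := 2 * ((m ^ 2)⁻¹ + (m ^ 3)⁻¹)) (x := y) (y := x) ?_ ?_ hy hx
  · simpa using h
  · intro t ht
    exact (Real.hasDerivAt_rpow_const (Or.inl (hm.trans_le ht).ne')).hasDerivWithinAt
  · intro t ht
    have ht0 : 0 < t := hm.trans_le ht
    have h1 : t ^ (-s - 1) ≤ m ^ (-s - 1) :=
      Real.rpow_le_rpow_of_nonpos hm ht (by linarith [hs.1])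
    have h2 : m ^ (-s - 1) ≤ (m ^ 2)⁻¹ + (m ^ 3)⁻¹ := by
      have e2 : (m ^ 2)⁻¹ = m ^ (-2 : ℝ) := by
        rw [Real.rpow_neg hm.le]; norm_cast
      have e3 : (m ^ 3)⁻¹ = m ^ (-3 : ℝ) := by
        rw [Real.rpow_neg hm.le]; norm_cast
      have p2 : 0 < (m ^ 2)⁻¹ := by positivity
      have p3 : 0 < (m ^ 3)⁻¹ := by positivity
      rcases le_total 1 m with h | h
      · have := Real.rpow_le_rpow_of_exponent_le h (show -s - 1 ≤ -2 by linarith [hs.1])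
        rw [← e2] at this
        linarith
      · have := Real.rpow_le_rpow_of_exponent_ge hm h (show -3 ≤ -s - 1 by linarith [hs.2])
        rw [← e3] at this
        linarith
    have h0 : 0 ≤ t ^ (-s - 1) := by positivity
    rw [Real.norm_eq_abs, abs_mul, abs_neg, abs_of_nonneg h0, abs_of_nonneg (by linarith [hs.1])]
    exact mul_le_mul hs.2 (h1.trans h2) h0 (by norm_num)

/-- The series known for Re s > 1 is continued to s = 1 by letting s → 1+; pairing n + a with n + 1
- a gives a summable bound independent of s. -/
lemma hasSum_hurwitzZetaOdd_one {a : ℝ} (ha : a ∈ Set.Ioo 0 1) :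
    HasSum (fun n : ℕ ↦ (1 / (n + a : ℂ) - 1 / (n + 1 - a : ℂ)) / 2) (hurwitzZetaOdd a 1) := by
  obtain ⟨ha0, ha1⟩ := ha
  set δ : ℝ := min a (1 - a) with hδ
  have hδ0 : 0 < δ := lt_min ha0 (by linarith)
  have hb1 (n : ℕ) : n + δ ≤ n + a := by linarith [min_le_left a (1 - a)]
  have hb2 (n : ℕ) : n + δ ≤ n + 1 - a := by linarith [min_le_right a (1 - a)]
  have hbp (n : ℕ) : 0 < n + δ := by positivity
  let f : ℝ → ℕ → ℂ := fun s n ↦ (((((n + a) ^ (-s) - (n + 1 - a) ^ (-s)) / 2 : ℝ)) : ℂ)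
  let bound : ℕ → ℝ := fun n ↦ (((n + δ) ^ 2)⁻¹ + ((n + δ) ^ 3)⁻¹) * |2 * a - 1|
  have hbound {s : ℝ} (hs : s ∈ Set.Icc (1 : ℝ) 2) (n : ℕ) : ‖f s n‖ ≤ bound n := by
    have := abs_rpow_neg_sub_rpow_neg_le (hbp n) (hb1 n) (hb2 n) hs
    rw [show (n + a : ℝ) - (n + 1 - a) = 2 * a - 1 by ring] at this
    simp only [f, bound, norm_real, Real.norm_eq_abs, abs_div, abs_two]
    linarith
  have hsum : Summable bound := by
    refine Summable.mul_right _ (Summable.add ?_ ?_)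
    · have := (Real.summable_one_div_nat_add_rpow δ 2).2 one_lt_two
      refine this.congr fun n ↦ ?_
      rw [abs_of_pos (hbp n)]; norm_cast; simp
    · have := (Real.summable_one_div_nat_add_rpow δ 3).2 (by norm_num)
      refine this.congr fun n ↦ ?_
      rw [abs_of_pos (hbp n)]; norm_cast; simp
  have hlim : Tendsto (fun s : ℝ ↦ ∑' n, f s n) (𝓝[>] 1) (𝓝 (∑' n, f 1 n)) := by
    refine tendsto_tsum_of_dominated_convergence hsum (fun n ↦ ?_) ?_
    · have h1 : (n + a : ℝ) ≠ 0 := ((hbp n).trans_le (hb1 n)).ne'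
      have h2 : (n + 1 - a : ℝ) ≠ 0 := ((hbp n).trans_le (hb2 n)).ne'
      have : ContinuousAt (fun s : ℝ ↦ f s n) 1 := by
        refine continuous_ofReal.continuousAt.comp (f := fun s : ℝ ↦
          ((n + a) ^ (-s) - (n + 1 - a) ^ (-s)) / 2) ?_
        refine ContinuousAt.div_const (ContinuousAt.sub ?_ ?_) 2
        · exact ContinuousAt.rpow continuousAt_const continuousAt_id.neg (Or.inl h1)
        · exact ContinuousAt.rpow continuousAt_const continuousAt_id.neg (Or.inl h2)
      exact this.tendsto.mono_left nhdsWithin_le_nhds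
    · filter_upwards [Ioc_mem_nhdsGT one_lt_two] with s hs n using hbound ⟨hs.1.le, hs.2⟩ n
  have hlim' : Tendsto (fun s : ℝ ↦ hurwitzZetaOdd a s) (𝓝[>] 1) (𝓝 (hurwitzZetaOdd a 1)) := by
    have : ContinuousAt (fun s : ℝ ↦ hurwitzZetaOdd a s) 1 :=
      ((differentiable_hurwitzZetaOdd a).continuous.comp continuous_ofReal).continuousAt
    simpa using this.tendsto.mono_left (nhdsWithin_le_nhds (s := Set.Ioi 1))
  have heq : hurwitzZetaOdd a 1 = ∑' n, f 1 n := by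
    refine tendsto_nhds_unique hlim' (hlim.congr' ?_)
    filter_upwards [self_mem_nhdsWithin] with s hs
    rw [← (hasSum_nat_hurwitzZetaOdd_of_mem_Icc ⟨ha0.le, ha1.le⟩
      (show 1 < (s : ℂ).re by simpa using hs)).tsum_eq]
    congr 1; ext n
    have h1 : (0 : ℝ) ≤ n + a := ((hbp n).trans_le (hb1 n)).le
    have h2 : (0 : ℝ) ≤ n + 1 - a := ((hbp n).trans_le (hb2 n)).le
    simp only [f]
    rw [Real.rpow_neg h1, Real.rpow_neg h2]
    push_cast [ofReal_cpow h1, ofReal_cpow h2]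
    simp
  rw [heq]
  refine (Summable.of_norm_bounded hsum (hbound (by norm_num))).hasSum.congr_fun fun n ↦ ?_
  simp [f, Real.rpow_neg_one]

lemma mem_integerComplement_of_mem_Ioo {a : ℝ} (ha : a ∈ Set.Ioo 0 1) :
    (a : ℂ) ∈ integerComplement := by
  rintro ⟨k, hk⟩
  have hk' : (k : ℝ) = a := by exact_mod_cast hk
  have h0 : (0 : ℝ) < k := hk' ▸ ha.1
  have h1 : (k : ℝ) < 1 := hk' ▸ ha.2
  norm_cast at h0 h1
  omega

lemma hurwitzZetaOdd_one {a : ℝ} (ha : a ∈ Set.Ioo 0 1) :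
    hurwitzZetaOdd a 1 = Real.pi * cot (Real.pi * a) / 2 := by
  have hai := mem_integerComplement_of_mem_Ioo ha
  have h1 := (hasSum_hurwitzZetaOdd_one ha).tendsto_sum_nat
  have h2 := ((summable_cotTerm hai).hasSum).tendsto_sum_nat
  have h3 : ∑' n, cotTerm (a : ℂ) n = Real.pi * cot (Real.pi * a) - 1 / a :=
    (cot_series_rep' hai).symm
  rw [h3] at h2
  -- The cotangent expansion pairs the poles differently: after adding 1/a, its N-th partial sum
  -- exceeds the required one by the single term 1/(a + N), which tends to 0.
  have h4 := ((h2.add_const (1 / (a : ℂ))).sub (tendsto_inv_add_natCast a)).div_const 2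
  refine tendsto_nhds_unique h1 ?_
  have h5 : Real.pi * cot (Real.pi * a) / 2
      = (Real.pi * cot (Real.pi * a) - 1 / (a : ℂ) + 1 / (a : ℂ) - 0) / 2 := by ring
  rw [h5]
  refine h4.congr fun N ↦ ?_
  induction N with
  | zero => simp
  | succ N ih =>
    rw [Finset.sum_range_succ, Finset.sum_range_succ, ← ih]
    have e : (N + 1 - a : ℂ) = -(a - (N + 1)) := by ring
    rw [e, cotTerm, div_neg]
    push_cast
    rw [add_comm (N : ℂ) a, one_div ((a : ℂ) + N)]
    simp only [one_div]
    ring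

lemma hurwitzZetaEven_natCast {m : ℕ} (hm : Even m) (h2 : 2 ≤ m) (a : ℝ) :
    hurwitzZetaEven a m = latticeSum m a / 2 := by
  have hs : 1 < (m : ℂ).re := by simpa using (by omega : 1 < m)
  refine (hasSum_int_hurwitzZetaEven a hs).unique ?_
  refine ((hasSum_latticeSum h2 a).div_const 2).congr_fun fun n ↦ ?_
  rw [cpow_natCast, ← ofReal_pow, hm.pow_abs]
  push_cast
  rw [inv_pow, one_div, add_comm (n : ℂ)]

lemma hurwitzZetaOdd_natCast {m : ℕ} (hm : Odd m) (h2 : 2 ≤ m) (a : ℝ) :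
    hurwitzZetaOdd a m = latticeSum m a / 2 := by
  have hs : 1 < (m : ℂ).re := by simpa using (by omega : 1 < m)
  refine (hasSum_int_hurwitzZetaOdd a hs).unique ?_
  refine ((hasSum_latticeSum h2 a).div_const 2).congr_fun fun n ↦ ?_
  have e : (a : ℂ) + n = ((n + a : ℝ) : ℂ) := by push_cast; ring
  rw [cpow_natCast, e]
  rcases lt_trichotomy ((n : ℝ) + a) 0 with h | h | h
  · rw [sign_neg h, abs_of_neg h, ofReal_neg, hm.neg_pow, inv_pow]
    simp
  · rw [h]; simp [show m ≠ 0 by omega]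
  · rw [sign_pos h, abs_of_pos h, inv_pow]
    simp

end HurwitzValues

/-! ### Reduction of the mean value to a sum over reduced residues. -/

section MeanValue

open Complex HurwitzZeta

/-- The function `π cot (π x)` for `m = 1`, and the lattice sum of exponent `m` otherwise. -/
noncomputable def cotSum (m : ℕ) (x : ℝ) : ℂ :=
  if m = 1 then Real.pi * cot (Real.pi * x) else latticeSum m x

lemma latticeSum_neg (m : ℕ) (x : ℂ) : latticeSum m (-x) = (-1) ^ m * latticeSum m x := by
  unfold latticeSum
  rw [← (Equiv.neg ℤ).tsum_eq, ← tsum_mul_left]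
  congr 1; ext k
  rw [← mul_pow, neg_one_mul, ← inv_neg, Equiv.neg_apply]
  push_cast
  rw [neg_add]

lemma cotSum_one_sub (m : ℕ) (x : ℝ) : cotSum m (1 - x) = (-1) ^ m * cotSum m x := by
  unfold cotSum
  split_ifs with h
  · subst h
    have : (Real.pi : ℂ) * ((1 - x : ℝ) : ℂ) = Real.pi - Real.pi * x := by push_cast; ring
    rw [this, cot, cot, cos_pi_sub, sin_pi_sub]
    ring
  · have := latticeSum_add_int m (-x) 1
    rw [latticeSum_neg] at this
    rw [← this]
    congr 1; push_cast; ring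

/-- Removes the residue 0, where the formulas on the open interval (0, 1) do not apply. -/
lemma map_zero_of_two_le {q : ℕ} (hq : 2 ≤ q) (χ : DirichletCharacter ℂ q) : χ 0 = 0 := by
  have : Fact (1 < q) := ⟨hq⟩
  exact χ.map_nonunit not_isUnit_zero

section ZMod

variable {q : ℕ} [NeZero q]

lemma zmod_val_div_mem_Ioo {a : ZMod q} (ha : a ≠ 0) : (a.val / q : ℝ) ∈ Set.Ioo 0 1 := by
  have hq : (0 : ℝ) < q := by exact_mod_cast NeZero.pos q
  constructor
  · have : 0 < a.val := Nat.pos_of_ne_zero ((ZMod.val_ne_zero a).2 ha)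
    positivity
  · rw [div_lt_one hq]
    exact_mod_cast a.val_lt

lemma cotSum_neg_val {a : ZMod q} (ha : a ≠ 0) (m : ℕ) :
    cotSum m ((-a).val / q) = (-1) ^ m * cotSum m (a.val / q) := by
  have hq : (q : ℝ) ≠ 0 := by exact_mod_cast NeZero.ne q
  rw [← cotSum_one_sub]
  congr 1
  rw [ZMod.neg_val, if_neg ha, Nat.cast_sub a.val_lt.le]
  field_simp

/-- The substitution a ↦ -a changes the sign of the sum. -/
lemma sum_mul_cotSum_eq_zero (hq : 2 ≤ q) (m : ℕ) {χ : DirichletCharacter ℂ q}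
    (hχ : χ (-1) ≠ (-1) ^ m) : ∑ a : ZMod q, χ a * cotSum m (a.val / q) = 0 := by
  have h1 : ∑ a : ZMod q, χ a * cotSum m (a.val / q)
      = χ (-1) * (-1) ^ m * ∑ a : ZMod q, χ a * cotSum m (a.val / q) := by
    rw [Finset.mul_sum]
    refine Fintype.sum_equiv (Equiv.neg _) _ _ fun a ↦ ?_
    rcases eq_or_ne a 0 with rfl | ha
    · simp [map_zero_of_two_le hq]
    · rw [Equiv.neg_apply, cotSum_neg_val ha, neg_eq_neg_one_mul a, map_mul]
      have e1 : χ (-1) * χ (-1) = 1 := by rw [← map_mul]; simp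
      have e2 : ((-1 : ℂ) ^ m) * (-1) ^ m = 1 := by rw [← mul_pow]; simp
      linear_combination (-(χ a * cotSum m (a.val / q)) * ((-1) ^ m * (-1) ^ m)) * e1
        - (χ a * cotSum m (a.val / q)) * e2
  have h2 : χ (-1) * (-1) ^ m = -1 := by
    rcases χ.even_or_odd with h | h <;> rcases neg_one_pow_eq_or ℂ m with h' | h' <;>
      simp_all [DirichletCharacter.Even, DirichletCharacter.Odd]
  rw [h2, neg_one_mul] at h1
  exact self_eq_neg.1 h1

/-- In the Hurwitz decomposition of L(s,χ) only the part with the parity of χ survives; its value at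
m is half of `cotSum m`, whence the 2. -/
lemma LFunction_natCast_eq_sum (hq : 2 ≤ q) {m : ℕ} (hm : 1 ≤ m) {χ : DirichletCharacter ℂ q}
    (hχ : χ (-1) = (-1) ^ m) :
    DirichletCharacter.LFunction χ m
      = (2 * (q : ℂ) ^ m)⁻¹ * ∑ a : ZMod q, χ a * cotSum m (a.val / q) := by
  have key (Z : UnitAddCircle → ℂ)
      (hZ : ∀ x ∈ Set.Ioo (0 : ℝ) 1, Z x = cotSum m x / 2) :
      (q : ℂ) ^ (-(m : ℂ)) * ∑ j : ZMod q, χ j * Z (ZMod.toAddCircle j)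
        = (2 * (q : ℂ) ^ m)⁻¹ * ∑ a : ZMod q, χ a * cotSum m (a.val / q) := by
    rw [cpow_neg, cpow_natCast, Finset.mul_sum, Finset.mul_sum]
    refine Finset.sum_congr rfl fun a _ ↦ ?_
    rcases eq_or_ne a 0 with rfl | ha
    · simp [map_zero_of_two_le hq]
    · rw [ZMod.toAddCircle_apply, hZ _ (zmod_val_div_mem_Ioo ha)]
      rw [mul_inv]
      ring
  rcases Nat.even_or_odd m with he | ho
  · have hev : χ.Even := by rw [DirichletCharacter.Even, hχ, he.neg_one_pow]
    have h2 : 2 ≤ m := by obtain ⟨r, rfl⟩ := he; omega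
    rw [DirichletCharacter.LFunction, ZMod.LFunction_def_even hev.to_fun]
    refine key (fun z ↦ hurwitzZetaEven z m) fun x hx ↦ ?_
    rw [hurwitzZetaEven_natCast he h2, cotSum, if_neg (by omega)]
  · have hod : χ.Odd := by rw [DirichletCharacter.Odd, hχ, ho.neg_one_pow]
    rw [DirichletCharacter.LFunction, ZMod.LFunction_def_odd hod.to_fun]
    refine key (fun z ↦ hurwitzZetaOdd z m) fun x hx ↦ ?_
    rcases eq_or_lt_of_le hm with rfl | h2
    · rw [Nat.cast_one, hurwitzZetaOdd_one hx, cotSum, if_pos rfl]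
    · rw [hurwitzZetaOdd_natCast ho h2, cotSum, if_neg (by omega)]

/-- Fourier inversion on the unit group of `ZMod q`. -/
lemma sum_inv_char_mul_sum (g : ZMod q → ℂ) (c : ZMod q) :
    ∑ χ : DirichletCharacter ℂ q, χ⁻¹ c * ∑ a, χ a * g a
      = if IsUnit c then (q.totient : ℂ) * g c else 0 := by
  split_ifs with hc
  · simp_rw [Finset.mul_sum]
    rw [Finset.sum_comm]
    have (a : ZMod q) : ∑ χ : DirichletCharacter ℂ q, χ⁻¹ c * (χ a * g a)
        = if c = a then (q.totient : ℂ) * g a else 0 := by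
      have := DirichletCharacter.sum_char_inv_mul_char_eq ℂ hc a
      simp_rw [← mul_assoc, ← Finset.sum_mul]
      have e : ∀ χ : DirichletCharacter ℂ q, χ⁻¹ c = χ c⁻¹ := fun χ ↦ by
        obtain ⟨u, rfl⟩ := hc
        rw [MulChar.inv_apply, Ring.inverse_unit, ZMod.inv_coe_unit]
      simp_rw [e, this, ite_mul, zero_mul]
    simp_rw [this]
    simp
  · refine Finset.sum_eq_zero fun χ _ ↦ ?_
    rw [χ⁻¹.map_nonunit hc, zero_mul]

-- Writing the third sum as a sum over c splits (χ₁χ₂)⁻¹(c) into two factors, leaving two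
-- independent Fourier inversions at c.
open Classical in
lemma sum_sum_char_mul (g₁ g₂ g₃ : ZMod q → ℂ) :
    ∑ χ₁ : DirichletCharacter ℂ q, ∑ χ₂ : DirichletCharacter ℂ q,
      (∑ a, χ₁ a * g₁ a) * (∑ a, χ₂ a * g₂ a) * (∑ a, (χ₁ * χ₂)⁻¹ a * g₃ a)
      = (q.totient : ℂ) ^ 2 * ∑ c : ZMod q with IsUnit c, g₁ c * g₂ c * g₃ c := by
  have h (c : ZMod q) :
      (∑ χ₁ : DirichletCharacter ℂ q, χ₁⁻¹ c * ∑ a, χ₁ a * g₁ a) *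
        (∑ χ₂ : DirichletCharacter ℂ q, χ₂⁻¹ c * ∑ a, χ₂ a * g₂ a) * g₃ c
      = if IsUnit c then (q.totient : ℂ) ^ 2 * (g₁ c * g₂ c * g₃ c) else 0 := by
    rw [sum_inv_char_mul_sum, sum_inv_char_mul_sum]
    split_ifs <;> ring
  rw [Finset.mul_sum, Finset.sum_filter,
    ← Finset.sum_congr (s₁ := Finset.univ) rfl fun c _ ↦ h c]
  have e (χ₁ χ₂ : DirichletCharacter ℂ q) :
      (∑ a, χ₁ a * g₁ a) * (∑ a, χ₂ a * g₂ a) * (∑ a, (χ₁ * χ₂)⁻¹ a * g₃ a)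
      = ∑ c, (χ₁⁻¹ c * ∑ a, χ₁ a * g₁ a) * (χ₂⁻¹ c * ∑ a, χ₂ a * g₂ a) * g₃ c := by
    rw [Finset.mul_sum]
    refine Finset.sum_congr rfl fun c _ ↦ ?_
    rw [mul_inv, MulChar.mul_apply]
    ring
  rw [Finset.sum_congr (s₁ := Finset.univ) rfl fun χ₁ _ ↦
    (Finset.sum_congr (s₁ := Finset.univ) rfl fun χ₂ _ ↦ e χ₁ χ₂).trans Finset.sum_comm,
    Finset.sum_comm]
  refine Finset.sum_congr rfl fun c _ ↦ ?_
  rw [Finset.sum_mul_sum, Finset.sum_mul]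
  exact Finset.sum_congr rfl fun χ₁ _ ↦ (Finset.sum_mul _ _ _).symm

open Classical in
/-- The mean value as a sum of products of cotangent sums over the reduced residues. -/
lemma meanValueL_eq_sum (hq : 2 ≤ q) {m₁ m₂ m₃ : ℕ} (h₁ : 1 ≤ m₁) (h₂ : 1 ≤ m₂) (h₃ : 1 ≤ m₃)
    (hpar : Even (m₁ + m₂ + m₃)) :
    meanValueL q m₁ m₂ m₃ 1 1 1 = (q.totient : ℂ) ^ 2 / (8 * (q : ℂ) ^ (m₁ + m₂ + m₃)) *
      ∑ c : ZMod q with IsUnit c,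
        cotSum m₁ (c.val / q) * cotSum m₂ (c.val / q) * cotSum m₃ (c.val / q) := by
  let T : ℕ → DirichletCharacter ℂ q → ℂ := fun m χ ↦ ∑ a : ZMod q, χ a * cotSum m (a.val / q)
  have hV : meanValueL q m₁ m₂ m₃ 1 1 1 = (8 * (q : ℂ) ^ (m₁ + m₂ + m₃))⁻¹ *
      ∑ χ₁ : DirichletCharacter ℂ q, ∑ χ₂ : DirichletCharacter ℂ q,
        T m₁ χ₁ * T m₂ χ₂ * T m₃ (χ₁ * χ₂)⁻¹ := by
    rw [meanValueL, Finset.sum_filter, Finset.mul_sum]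
    refine Finset.sum_congr rfl fun χ₁ _ ↦ ?_
    split_ifs with hχ₁
    · rw [Finset.sum_filter, Finset.mul_sum]
      refine Finset.sum_congr rfl fun χ₂ _ ↦ ?_
      split_ifs with hχ₂
      -- As m₁ + m₂ + m₃ is even, the third character automatically has the right parity.
      · have hχ₃ : (χ₁ * χ₂)⁻¹ (-1) = (-1) ^ m₃ := by
          rw [MulChar.inv_apply, show (-1 : ZMod q) = ((-1 : (ZMod q)ˣ) : ZMod q) by simp,
            Ring.inverse_unit]
          simp only [inv_neg_one, Units.val_neg, Units.val_one, MulChar.mul_apply, hχ₁, hχ₂]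
          rw [← pow_add]
          rcases Nat.even_or_odd m₃ with h | h
          · rw [h.neg_one_pow, ((Nat.even_add.1 hpar).2 h).neg_one_pow]
          · rw [h.neg_one_pow]
            refine Odd.neg_one_pow ?_
            rw [← Nat.not_even_iff_odd] at h ⊢
            exact fun h' ↦ h ((Nat.even_add.1 hpar).1 h')
        rw [MulChar.star_eq_inv, LFunction_natCast_eq_sum hq h₁ hχ₁,
          LFunction_natCast_eq_sum hq h₂ hχ₂, LFunction_natCast_eq_sum hq h₃ hχ₃]
        simp only [Int.cast_one, map_one, T]
        have : (q : ℂ) ≠ 0 := by exact_mod_cast NeZero.ne q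
        field_simp
        ring
      · rw [show T m₂ χ₂ = 0 from sum_mul_cotSum_eq_zero hq m₂ hχ₂]
        simp
    · rw [show T m₁ χ₁ = 0 from sum_mul_cotSum_eq_zero hq m₁ hχ₁]
      simp
  rw [hV, sum_sum_char_mul]
  ring

-- For even m this is 2q^m L(m, χ₀) with χ₀ trivial, and the Euler factors missing from ζ(m) build
-- J_m(q). For odd m both sides vanish.
open Classical in
lemma sum_units_latticeSum (hq : 2 ≤ q) {m : ℕ} (hm : 2 ≤ m) :
    ∑ c : ZMod q with IsUnit c, latticeSum m (c.val / q : ℝ)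
      = intZeta m * (jordanTotient m q : ℂ) := by
  have hT : ∑ c : ZMod q with IsUnit c, latticeSum m (c.val / q : ℝ)
      = ∑ a : ZMod q, (1 : DirichletCharacter ℂ q) a * cotSum m (a.val / q) := by
    rw [Finset.sum_filter]
    refine Finset.sum_congr rfl fun a _ ↦ ?_
    split_ifs with ha
    · rw [MulChar.one_apply ha, one_mul, cotSum, if_neg (by omega)]
    · rw [MulChar.map_nonunit _ ha, zero_mul]
  have h1 : (1 : DirichletCharacter ℂ q) (-1) = 1 := MulChar.one_apply isUnit_one.neg
  rw [hT]
  rcases Nat.even_or_odd m with he | ho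
  · have hL := LFunction_natCast_eq_sum hq (m := m) (χ := 1) (by omega)
      (by rw [h1, he.neg_one_pow])
    have hL' := DirichletCharacter.LFunctionTrivChar_eq_mul_riemannZeta (N := q) (s := m)
      (by exact_mod_cast (by omega : m ≠ 1))
    rw [DirichletCharacter.LFunctionTrivChar, hL] at hL'
    have hq0 : (q : ℂ) ≠ 0 := by exact_mod_cast NeZero.ne q
    rw [inv_mul_eq_iff_eq_mul₀ (by simp [hq0])] at hL'
    rw [hL', intZeta_even he hm, jordanTotient]
    push_cast
    simp_rw [cpow_neg, cpow_natCast, one_div]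
    ring
  · rw [intZeta_odd ho, zero_mul]
    refine sum_mul_cotSum_eq_zero hq m ?_
    rw [h1, ho.neg_one_pow]
    norm_num

/-- The mean value in terms of Jordan totients and `ζ`-values. -/
lemma meanValueL_one_two_eq_intZeta (hq : 2 ≤ q) {n : ℕ} (hn : 2 ≤ n) (ho : Odd n) :
    meanValueL q 1 2 n 1 1 1 = (q.totient : ℂ) ^ 2 / (8 * (q : ℂ) ^ (n + 3)) *
      (intZeta (n + 3) * (jordanTotient (n + 3) q : ℂ)
        - n * intZeta (n + 1) * (intZeta 2 * (jordanTotient 2 q : ℂ))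
        - ∑ j ∈ Finset.Icc 2 n, (n + 2 - j).choose 2 * intZeta (n + 3 - j) *
            (intZeta j * (jordanTotient j q : ℂ))) := by
  classical
  rw [meanValueL_eq_sum hq le_rfl one_le_two (by omega) (by
    rw [show 1 + 2 + n = n + 3 by omega]; exact ho.add_odd (by decide)),
    show 1 + 2 + n = n + 3 by omega]
  congr 1
  have hc : ∀ c ∈ Finset.univ.filter (fun c : ZMod q ↦ IsUnit c),
      cotSum 1 (c.val / q) * cotSum 2 (c.val / q) * cotSum n (c.val / q)
      = latticeSum (n + 3) (c.val / q : ℝ)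
        - n * intZeta (n + 1) * latticeSum 2 (c.val / q : ℝ)
        - ∑ j ∈ Finset.Icc 2 n, (n + 2 - j).choose 2 * intZeta (n + 3 - j) *
          latticeSum j (c.val / q : ℝ) := by
    intro c hc
    have : Fact (1 < q) := ⟨hq⟩
    have hx := mem_integerComplement_of_mem_Ioo
      (zmod_val_div_mem_Ioo (Finset.mem_filter.1 hc).2.ne_zero)
    -- Oddness of n removes the term `intZeta n * latticeSum 3 x`.
    rw [cotSum, if_pos rfl, cotSum, if_neg (by norm_num), cotSum, if_neg (by omega),
      pi_cot_mul_latticeSum_two hx, latticeSum_three_mul hx hn, intZeta_odd ho]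
    ring
  rw [Finset.sum_congr rfl hc, Finset.sum_sub_distrib, Finset.sum_sub_distrib,
    ← Finset.mul_sum, Finset.sum_comm, sum_units_latticeSum hq (by omega),
    sum_units_latticeSum hq le_rfl]
  congr 1
  refine Finset.sum_congr rfl fun j hj ↦ ?_
  rw [← Finset.mul_sum, sum_units_latticeSum hq (Finset.mem_Icc.1 hj).1]

end ZMod

end MeanValue

/-! ### Convolution identities for Bernoulli numbers. -/

section PowerSeriesIdentity
open PowerSeries

/-- Differentiate B(X)(e^X - 1) = X, multiply by B and eliminate e^X. -/
lemma bernoulliPowerSeries_sq :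
    bernoulliPowerSeries ℚ ^ 2 = bernoulliPowerSeries ℚ - X * bernoulliPowerSeries ℚ
      - X * derivative ℚ (bernoulliPowerSeries ℚ) := by
  have h := bernoulliPowerSeries_mul_exp_sub_one ℚ
  have hd := congrArg (derivative ℚ) h
  have hX : derivative ℚ (X : ℚ⟦X⟧) = 1 := derivative_X
  have he : derivative ℚ (exp ℚ) = exp ℚ := derivative_exp ℚ
  rw [Derivation.leibniz, map_sub, hX, he, Derivation.map_one_eq_zero, sub_zero, smul_eq_mul,
    smul_eq_mul] at hd
  linear_combination bernoulliPowerSeries ℚ * hd -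
    (derivative ℚ (bernoulliPowerSeries ℚ) + bernoulliPowerSeries ℚ) * h

end PowerSeriesIdentity

lemma sum_antidiagonal_choose_mul_bernoulli (K : ℕ) :
    ∑ p ∈ Finset.HasAntidiagonal.antidiagonal (K + 1), ((K + 1).choose p.1 : ℚ) * bernoulli p.1 * bernoulli p.2
      = -(K + 1) * bernoulli K - K * bernoulli (K + 1) := by
  have h := congrArg (PowerSeries.coeff (K + 1)) bernoulliPowerSeries_sq
  rw [pow_two, PowerSeries.coeff_mul, map_sub, map_sub, PowerSeries.coeff_succ_X_mul,
    PowerSeries.coeff_succ_X_mul, PowerSeries.coeff_derivative] at h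
  simp only [bernoulliPowerSeries, PowerSeries.coeff_mk, Algebra.algebraMap_self,
    RingHom.id_apply] at h
  have hf : ((K + 1).factorial : ℚ) = (K + 1) * K.factorial := by
    rw [Nat.factorial_succ]; push_cast; ring
  have hK : (K.factorial : ℚ) ≠ 0 := by positivity
  have hK1 : (K : ℚ) + 1 ≠ 0 := by positivity
  have h2 := congrArg (((K + 1).factorial : ℚ) * ·) h
  simp only [Finset.mul_sum] at h2
  rw [show -((K : ℚ) + 1) * bernoulli K - K * bernoulli (K + 1) = ((K + 1).factorial : ℚ) *
    (bernoulli (K + 1) / ((K + 1).factorial : ℚ) - bernoulli K / (K.factorial : ℚ)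
      - bernoulli (K + 1) / ((K + 1).factorial : ℚ) * (K + 1)) by
        rw [hf]; field_simp; ring, ← h2]
  refine Finset.sum_congr rfl fun p hp ↦ ?_
  rw [Finset.HasAntidiagonal.mem_antidiagonal] at hp
  rw [← hp, Nat.cast_add_choose]
  ring

/-- Euler's convolution identity for Bernoulli numbers. -/
lemma sum_choose_mul_bernoulli_mul_bernoulli {K : ℕ} (hK : 4 ≤ K) (he : Even K) :
    ∑ u ∈ Finset.Icc 2 (K - 2), (K.choose u : ℚ) * bernoulli u * bernoulli (K - u)
      = -(K + 1) * bernoulli K := by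
  obtain ⟨K, rfl⟩ : ∃ L, K = L + 4 := ⟨K - 4, by omega⟩
  have h := sum_antidiagonal_choose_mul_bernoulli (K + 3)
  have hb : bernoulli (K + 3) = 0 :=
    bernoulli_eq_zero_of_odd (by obtain ⟨r, hr⟩ := he; exact ⟨r - 1, by omega⟩) (by omega)
  -- Two terms are split off at each end: the outermost give twice the top Bernoulli number, the
  -- next ones contain a vanishing odd-index one.
  rw [Finset.Nat.sum_antidiagonal_eq_sum_range_succ_mk, Finset.sum_range_succ,
    Finset.sum_range_succ, Finset.sum_range_succ', Finset.sum_range_succ'] at h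
  have e : ∑ u ∈ Finset.Icc 2 (K + 4 - 2), ((K + 4).choose u : ℚ) * bernoulli u *
      bernoulli (K + 4 - u) = ∑ k ∈ Finset.range (K + 1), ((K + 4).choose (k + 1 + 1) : ℚ) *
      bernoulli (k + 1 + 1) * bernoulli (K + 4 - (k + 1 + 1)) := by
    rw [← Finset.Ico_succ_right_eq_Icc, Finset.sum_Ico_eq_sum_range]
    refine Finset.sum_congr (by congr 1) fun k _ ↦ ?_
    rw [show 2 + k = k + 1 + 1 by ring]
  rw [e]
  simp only [add_assoc, Nat.reduceAdd, hb, zero_add, Nat.choose_zero_right, Nat.choose_self,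
    bernoulli_zero, Nat.sub_self, Nat.sub_zero, show K + 4 - 1 = K + 3 by omega, mul_zero,
    zero_mul, add_zero] at h ⊢
  push_cast at h ⊢
  linarith

/-- Add the sum to its reflection under i ↦ M + 1 - i. Pascal's rule gives C(M+1,i), and
C(M+1,i)/((i+1)(M+2-i)) = C(M+3,i+1)/((M+3)(M+2)), so twice the sum is Euler's convolution for K = M
+ 3. -/
lemma sum_choose_mul_bernoulli_div {M : ℕ} (hM : Odd M) :
    ∑ i ∈ Finset.Icc 1 M, (M.choose i : ℚ) * (bernoulli (M + 2 - i) / ((M : ℚ) + 2 - i)) *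
      (bernoulli (i + 1) / ((i : ℚ) + 1))
      = -((M : ℚ) + 4) * bernoulli (M + 3) / (2 * ((M + 3) * (M + 2))) := by
  set S := ∑ i ∈ Finset.Icc 1 M, (M.choose i : ℚ) * (bernoulli (M + 2 - i) / ((M : ℚ) + 2 - i)) *
      (bernoulli (i + 1) / ((i : ℚ) + 1)) with hS
  have hS' : S = ∑ i ∈ Finset.Icc 1 M, (M.choose (i - 1) : ℚ) *
      (bernoulli (M + 2 - i) / ((M : ℚ) + 2 - i)) * (bernoulli (i + 1) / ((i : ℚ) + 1)) := by
    rw [hS]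
    refine Finset.sum_bij' (fun i _ ↦ M + 1 - i) (fun i _ ↦ M + 1 - i) ?_ ?_ ?_ ?_ ?_
    · intro i hi; rw [Finset.mem_Icc] at hi ⊢; omega
    · intro i hi; rw [Finset.mem_Icc] at hi ⊢; omega
    · intro i hi; rw [Finset.mem_Icc] at hi; omega
    · intro i hi; rw [Finset.mem_Icc] at hi; omega
    · intro i hi
      rw [Finset.mem_Icc] at hi
      rw [show M + 1 - i - 1 = M - i by omega, Nat.choose_symm hi.2,
        show M + 2 - (M + 1 - i) = i + 1 by omega, show M + 1 - i + 1 = M + 2 - i by omega,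
        Nat.cast_sub (by omega)]
      push_cast
      rw [show (M : ℚ) + 2 - (M + 1 - i) = i + 1 by ring,
        show (M : ℚ) + 1 - i + 1 = M + 2 - i by ring]
      ring
  have hE := sum_choose_mul_bernoulli_mul_bernoulli (K := M + 3)
    (by obtain ⟨r, rfl⟩ := hM; omega) (hM.add_odd (by decide))
  have h2S : 2 * S = (∑ u ∈ Finset.Icc 2 (M + 3 - 2), ((M + 3).choose u : ℚ) * bernoulli u *
      bernoulli (M + 3 - u)) / ((M + 3) * (M + 2)) := by
    rw [two_mul]
    nth_rw 2 [hS']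
    rw [hS, ← Finset.sum_add_distrib, Finset.sum_div]
    refine Finset.sum_bij' (fun i _ ↦ i + 1) (fun i _ ↦ i - 1) ?_ ?_ ?_ ?_ ?_
    · intro i hi; rw [Finset.mem_Icc] at hi ⊢; omega
    · intro i hi; rw [Finset.mem_Icc] at hi ⊢; omega
    · intro i hi; rw [Finset.mem_Icc] at hi; omega
    · intro i hi; rw [Finset.mem_Icc] at hi; omega
    · intro i hi
      rw [Finset.mem_Icc] at hi
      obtain ⟨i, rfl⟩ : ∃ k, i = k + 1 := ⟨i - 1, by omega⟩
      obtain ⟨r, rfl⟩ : ∃ r, M = i + 1 + r := ⟨M - (i + 1), by omega⟩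
      rw [show i + 1 + r + 2 - (i + 1) = r + 2 by omega,
        show i + 1 + r + 3 - (i + 1 + 1) = r + 2 by omega, show i + 1 - 1 = i by omega]
      have c1 := Nat.cast_add_choose ℚ (a := i + 1) (b := r)
      have c2 := Nat.cast_add_choose ℚ (a := i) (b := r + 1)
      have c3 := Nat.cast_add_choose ℚ (a := i + 2) (b := r + 2)
      rw [show i + (r + 1) = i + 1 + r by ring] at c2
      rw [show i + 2 + (r + 2) = i + 1 + r + 3 by ring] at c3
      rw [c1, c2, show i + 1 + 1 = i + 2 by ring, c3]
      have f1 : ((i + 1 + r + 3).factorial : ℚ) = (i + r + 4) * (i + r + 3) * (i + r + 2) *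
          (i + 1 + r).factorial := by
        simp only [Nat.factorial_succ]; push_cast; ring
      have f2 : ((i + 1).factorial : ℚ) = (i + 1) * i.factorial := by
        simp only [Nat.factorial_succ]; push_cast; ring
      have f3 : ((i + 2).factorial : ℚ) = (i + 2) * (i + 1) * i.factorial := by
        simp only [Nat.factorial_succ]; push_cast; ring
      have f4 : ((r + 1).factorial : ℚ) = (r + 1) * r.factorial := by
        simp only [Nat.factorial_succ]; push_cast; ring
      have f5 : ((r + 2).factorial : ℚ) = (r + 2) * (r + 1) * r.factorial := by
        simp only [Nat.factorial_succ]; push_cast; ring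
      rw [f1, f2, f3, f4, f5]
      have g1 : (i.factorial : ℚ) ≠ 0 := by positivity
      have g2 : (r.factorial : ℚ) ≠ 0 := by positivity
      have d1 : ((i + 1 + r : ℕ) : ℚ) + 2 - ((i + 1 : ℕ) : ℚ) = r + 2 := by push_cast; ring
      have d2 : ((i + 1 : ℕ) : ℚ) + 1 = i + 2 := by push_cast; ring
      have d3 : ((i + 1 + r : ℕ) : ℚ) + 3 = i + r + 4 := by push_cast; ring
      have d4 : ((i + 1 + r : ℕ) : ℚ) + 2 = i + r + 3 := by push_cast; ring
      rw [d1, d2, d3, d4]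
      have e1 : (r : ℚ) + 2 ≠ 0 := by positivity
      have e2 : (r : ℚ) + 1 ≠ 0 := by positivity
      have e3 : (i : ℚ) + 2 ≠ 0 := by positivity
      have e4 : (i : ℚ) + 1 ≠ 0 := by positivity
      have e5 : (i : ℚ) + r + 4 ≠ 0 := by positivity
      have e6 : (i : ℚ) + r + 3 ≠ 0 := by positivity
      field_simp
      ring
  rw [hE] at h2S
  push_cast at h2S
  have : S = (2 * S) / 2 := by ring
  rw [this, h2S]
  field_simp
  ring

/-! ### Closed form of the rational factor. -/

/-- The added odd indices are at least 3, where B_j = 0. -/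
lemma sumN₁_eq (q : ℕ) {n : ℕ} (ho : Odd n) :
    sumN₁ q n = -∑ j ∈ Finset.Icc 2 n, (n.choose j : ℚ) *
      (bernoulli j * bernoulli (n + 3 - j) * jordanTotient j q /
        (((n : ℚ) + 3 - j) * ((n : ℚ) + 2 - j))) := by
  rw [sumN₁]
  congr 1
  obtain ⟨r, rfl⟩ := ho
  refine Finset.sum_of_injOn (fun j ↦ 2 * j) (fun a _ b _ h ↦ by simpa using h) ?_ ?_ ?_
  · intro j hj
    simp only [Finset.coe_Icc, Set.mem_Icc] at hj ⊢
    omega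
  · intro j hj hj'
    rw [Finset.mem_Icc] at hj
    have hjo : Odd j := by
      rw [← Nat.not_even_iff_odd]
      rintro ⟨k, rfl⟩
      refine hj' ⟨k, ?_, by ring⟩
      simp only [Finset.coe_Icc, Set.mem_Icc]
      omega
    have : bernoulli j = 0 := bernoulli_eq_zero_of_odd hjo (by omega)
    simp [this]
  · intro j _
    push_cast
    rfl

/-- Swap the sums and use C(n,j)C(j,l) = C(n,l)C(n-l,j-l). The inner sum is then
`sum_choose_mul_bernoulli_div` for M = n - l, which is odd because only even l contribute. -/
lemma sumN₂_eq (q : ℕ) {n : ℕ} (ho : Odd n) :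
    sumN₂ q n = -∑ l ∈ Finset.Icc 2 n, (n.choose l : ℚ) *
      (bernoulli l * bernoulli (n + 3 - l) * jordanTotient l q * ((n : ℚ) + 4 - l) /
        (2 * (((n : ℚ) + 3 - l) * ((n : ℚ) + 2 - l)))) := by
  rw [sumN₂]
  simp_rw [Finset.mul_sum]
  rw [Finset.sum_comm' (t' := Finset.Icc 2 n) (s' := fun l ↦ Finset.Icc (l + 1) n)
    (by intro x y; simp only [Finset.mem_Icc]; omega), ← Finset.sum_neg_distrib]
  refine Finset.sum_congr rfl fun l hl ↦ ?_
  rw [Finset.mem_Icc] at hl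
  rcases Nat.even_or_odd l with he | hlo
  swap
  · have : bernoulli l = 0 := bernoulli_eq_zero_of_odd hlo (by omega)
    simp [this]
  have hM : Odd (n - l) := Nat.Odd.sub_even hl.2 ho he
  have hS := sum_choose_mul_bernoulli_div hM
  have hcast : ((n - l : ℕ) : ℚ) = n - l := Nat.cast_sub hl.2
  have e : ∑ j ∈ Finset.Icc (l + 1) n, (n.choose j : ℚ) *
      (bernoulli (n + 2 - j) / ((n : ℚ) + 2 - j)) * ((j.choose l : ℚ) *
        (bernoulli l * bernoulli (j + 1 - l) * jordanTotient l q / ((j : ℚ) + 1 - l)))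
      = (n.choose l : ℚ) * (bernoulli l * jordanTotient l q) *
        ∑ i ∈ Finset.Icc 1 (n - l), ((n - l).choose i : ℚ) *
          (bernoulli (n - l + 2 - i) / (((n - l : ℕ) : ℚ) + 2 - i)) *
          (bernoulli (i + 1) / ((i : ℚ) + 1)) := by
    rw [Finset.mul_sum]
    refine Finset.sum_bij' (fun j _ ↦ j - l) (fun i _ ↦ i + l) ?_ ?_ ?_ ?_ ?_
    · intro j hj; rw [Finset.mem_Icc] at hj ⊢; omega
    · intro i hi; rw [Finset.mem_Icc] at hi ⊢; omega
    · intro j hj; rw [Finset.mem_Icc] at hj; omega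
    · intro i hi; omega
    · intro j hj
      rw [Finset.mem_Icc] at hj
      have hc : (n.choose j : ℚ) * (j.choose l : ℚ)
          = (n.choose l : ℚ) * ((n - l).choose (j - l) : ℚ) := by
        exact_mod_cast Nat.choose_mul (n := n) (k := j) (s := l) (by omega)
      rw [show n - l + 2 - (j - l) = n + 2 - j by omega, show j - l + 1 = j + 1 - l by omega,
        hcast, Nat.cast_sub (show l ≤ j by omega),
        show (n : ℚ) - l + 2 - (j - l) = n + 2 - j by ring,
        show (j : ℚ) - l + 1 = j + 1 - l by ring]
      linear_combination (bernoulli (n + 2 - j) / ((n : ℚ) + 2 - j)) * (bernoulli l *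
        bernoulli (j + 1 - l) * jordanTotient l q / ((j : ℚ) + 1 - l)) * hc
  rw [e, hS, hcast, show n - l + 3 = n + 3 - l by omega,
    show (n : ℚ) - l + 3 = n + 3 - l by ring, show (n : ℚ) - l + 2 = n + 2 - l by ring,
    show (n : ℚ) - l + 4 = n + 4 - l by ring]
  ring

/-- Closed form of the rational factor, with the double sum evaluated. -/
lemma sumN₁_sub_sumN₂_add_sumN₃ (q : ℕ) {n : ℕ} (ho : Odd n) :
    sumN₁ q n - sumN₂ q n + sumN₃ q n
      = (∑ j ∈ Finset.Icc 2 n, (n.choose j : ℚ) *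
          (bernoulli j * bernoulli (n + 3 - j) * jordanTotient j q / (2 * ((n : ℚ) + 3 - j))))
        + ((n : ℚ) * bernoulli 2 * bernoulli (n + 1) * jordanTotient 2 q / (2 * ((n : ℚ) + 1)) +
          bernoulli (n + 3) * jordanTotient (n + 3) q /
            (((n : ℚ) + 3) * ((n : ℚ) + 2) * ((n : ℚ) + 1))) := by
  rw [sumN₁_eq q ho, sumN₂_eq q ho, sumN₃]
  congr 1
  rw [sub_neg_eq_add, neg_add_eq_sub, ← Finset.sum_sub_distrib]
  -- Termwise, -1 + (n+4-j)/2 = (n+2-j)/2 cancels one denominator.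
  refine Finset.sum_congr rfl fun j hj ↦ ?_
  have hj' : (j : ℚ) ≤ n := by exact_mod_cast (Finset.mem_Icc.1 hj).2
  have h3 : (n : ℚ) + 3 - j ≠ 0 := by linarith
  have h2 : (n : ℚ) + 2 - j ≠ 0 := by linarith
  field_simp
  ring

/-! ### From zeta values to Bernoulli numbers. -/

-- The power of `I` absorbs the alternating sign in Euler's formula, so one expression covers both
-- parities.
open Complex in
lemma intZeta_eq_bernoulli {m : ℕ} (hm : 2 ≤ m) :
    intZeta m = -(2 * Real.pi * I) ^ m * bernoulli m / m.factorial := by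
  rcases Nat.even_or_odd m with he | ho
  · obtain ⟨k, rfl⟩ := he.two_dvd
    have hk : k ≠ 0 := by omega
    obtain ⟨r, rfl⟩ : ∃ r, k = r + 1 := ⟨k - 1, by omega⟩
    rw [intZeta_even he hm]
    push_cast
    have := riemannZeta_two_mul_nat hk
    push_cast at this
    rw [this, mul_pow _ I, pow_mul I, I_sq, show 2 * (r + 1) - 1 = 2 * r + 1 by omega]
    ring
  · rw [intZeta_odd ho, bernoulli_eq_zero_of_odd ho (by omega)]
    simp

open Complex in
lemma meanValueL_one_two_odd (q : ℕ) [NeZero q] (hq : 2 ≤ q) {n : ℕ} (hn : 2 ≤ n) (ho : Odd n) :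
    meanValueL q 1 2 n 1 1 1 =
      (-1) ^ ((n + 1) / 2) * (2 * (Real.pi : ℂ)) ^ (n + 3) * (Nat.totient q : ℂ) ^ 2 /
          (8 * (q : ℂ) ^ (n + 3) * (Nat.factorial n : ℂ)) *
        ((sumN₁ q n - sumN₂ q n + sumN₃ q n : ℚ) : ℂ) := by
  have hsign : (2 * (Real.pi : ℂ) * I) ^ (n + 3)
      = -((-1) ^ ((n + 1) / 2) * (2 * (Real.pi : ℂ)) ^ (n + 3)) := by
    obtain ⟨r, rfl⟩ := ho
    rw [mul_pow _ I, show 2 * r + 1 + 3 = 2 * (r + 2) by ring, pow_mul I, I_sq,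
      show (2 * r + 1 + 1) / 2 = r + 1 by omega]
    ring
  have hf0 : (n.factorial : ℂ) ≠ 0 := by exact_mod_cast n.factorial_ne_zero
  -- With s = n - j, C(s+2,2)/(s+3)! = 1/(2(s+3) s!), and s! combines with j! into C(n,j)/n!.
  have hterm : ∀ j ∈ Finset.Icc 2 n, ((n + 2 - j).choose 2 : ℂ) * intZeta (n + 3 - j) *
      (intZeta j * (jordanTotient j q : ℂ)) = (2 * (Real.pi : ℂ) * I) ^ (n + 3) / n.factorial *
      ((n.choose j : ℂ) * (bernoulli j * bernoulli (n + 3 - j) * jordanTotient j q /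
        (2 * ((n : ℂ) + 3 - j)))) := by
    intro j hj
    rw [Finset.mem_Icc] at hj
    obtain ⟨s, rfl⟩ : ∃ s, n = j + s := ⟨n - j, by omega⟩
    rw [intZeta_eq_bernoulli hj.1, intZeta_eq_bernoulli (by omega),
      show j + s + 3 - j = s + 3 by omega, show j + s + 2 - j = s + 2 by omega,
      Nat.cast_add_choose, Nat.cast_choose_two]
    have f1 : ((s + 3).factorial : ℂ) = (s + 3) * (s + 2) * (s + 1) * s.factorial := by
      simp only [Nat.factorial_succ]; push_cast; ring
    have g1 : (j.factorial : ℂ) ≠ 0 := by exact_mod_cast j.factorial_ne_zero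
    have g2 : (s.factorial : ℂ) ≠ 0 := by exact_mod_cast s.factorial_ne_zero
    have e1 : (s : ℂ) + 1 ≠ 0 := by exact_mod_cast s.succ_ne_zero
    have e2 : (s : ℂ) + 2 ≠ 0 := by exact_mod_cast (s + 1).succ_ne_zero
    have e3 : (s : ℂ) + 3 ≠ 0 := by exact_mod_cast (s + 2).succ_ne_zero
    rw [f1]
    push_cast
    rw [show (j : ℂ) + s + 3 - j = s + 3 by ring, show (s : ℂ) + 2 - 1 = s + 1 by ring,
      show j + s + 3 = j + (s + 3) by ring, pow_add _ j (s + 3)]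
    field_simp
  have f1 : ((n + 1).factorial : ℂ) = (n + 1) * n.factorial := by
    simp only [Nat.factorial_succ]; push_cast; ring
  have f3 : ((n + 3).factorial : ℂ) = (n + 3) * (n + 2) * (n + 1) * n.factorial := by
    simp only [Nat.factorial_succ]; push_cast; ring
  have e1 : (n : ℂ) + 1 ≠ 0 := by exact_mod_cast n.succ_ne_zero
  have e2 : (n : ℂ) + 2 ≠ 0 := by exact_mod_cast (n + 1).succ_ne_zero
  have e3 : (n : ℂ) + 3 ≠ 0 := by exact_mod_cast (n + 2).succ_ne_zero
  have hq0 : (q : ℂ) ≠ 0 := by exact_mod_cast NeZero.ne q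
  have h4 : (n : ℂ) * intZeta (n + 1) * (intZeta 2 * (jordanTotient 2 q : ℂ))
      = (2 * (Real.pi : ℂ) * I) ^ (n + 3) / n.factorial *
        (n * bernoulli 2 * bernoulli (n + 1) * jordanTotient 2 q / (2 * ((n : ℂ) + 1))) := by
    rw [intZeta_eq_bernoulli (m := 2) le_rfl, intZeta_eq_bernoulli (m := n + 1) (by omega), f1,
      show n + 3 = n + 1 + 2 by ring, pow_add _ (n + 1) 2]
    simp only [Nat.factorial_two, Nat.cast_ofNat]
    field_simp
  have h5 : intZeta (n + 3) * (jordanTotient (n + 3) q : ℂ)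
      = -((2 * (Real.pi : ℂ) * I) ^ (n + 3) / n.factorial *
        (bernoulli (n + 3) * jordanTotient (n + 3) q /
          (((n : ℂ) + 3) * ((n : ℂ) + 2) * ((n : ℂ) + 1)))) := by
    rw [intZeta_eq_bernoulli (by omega), f3]
    field_simp
  rw [meanValueL_one_two_eq_intZeta hq hn ho, sumN₁_sub_sumN₂_add_sumN₃ q ho,
    Finset.sum_congr rfl hterm, ← Finset.mul_sum, h4, h5, hsign]
  push_cast
  field_simp
  ring

/-! ### Explicit values for n = 3 and n = 5. -/

lemma bernoulli_three : bernoulli 3 = 0 := bernoulli_eq_zero_of_odd (by decide) (by norm_num)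

lemma bernoulli_five : bernoulli 5 = 0 := bernoulli_eq_zero_of_odd (by decide) (by norm_num)

lemma bernoulli_four : bernoulli 4 = -1 / 30 := by
  rw [bernoulli_eq_bernoulli'_of_ne_one (by norm_num), bernoulli'_four]

/-- Euler's convolution identity is a recursion for the top Bernoulli number. -/
lemma bernoulli_six : bernoulli 6 = 1 / 42 := by
  have h := sum_choose_mul_bernoulli_mul_bernoulli (K := 6) (by norm_num) (by decide)
  simp only [show (6 - 2 : ℕ) = 4 from rfl, show Finset.Icc 2 4 = {2, 3, 4} from rfl] at h
  norm_num [bernoulli_two, bernoulli_three, bernoulli_four, Nat.choose] at h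
  linarith

lemma bernoulli_eight : bernoulli 8 = -1 / 30 := by
  have h := sum_choose_mul_bernoulli_mul_bernoulli (K := 8) (by norm_num) (by decide)
  simp only [show (8 - 2 : ℕ) = 6 from rfl, show Finset.Icc 2 6 = {2, 3, 4, 5, 6} from rfl] at h
  norm_num [bernoulli_two, bernoulli_three, bernoulli_four, bernoulli_five, bernoulli_six,
    Nat.choose] at h
  linarith

lemma sumN_three (q : ℕ) : sumN₁ q 3 - sumN₂ q 3 + sumN₃ q 3
    = (jordanTotient 6 q - 21 * jordanTotient 2 q) / 5040 := by
  rw [sumN₁_sub_sumN₂_add_sumN₃ q (by decide), show Finset.Icc 2 3 = {2, 3} from rfl]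
  norm_num [bernoulli_two, bernoulli_three, bernoulli_four, bernoulli_six, Nat.choose]
  ring

lemma sumN_five (q : ℕ) : sumN₁ q 5 - sumN₂ q 5 + sumN₃ q 5
    = -(jordanTotient 8 q - 7 * jordanTotient 4 q - 50 * jordanTotient 2 q) / 10080 := by
  rw [sumN₁_sub_sumN₂_add_sumN₃ q (by decide), show Finset.Icc 2 5 = {2, 3, 4, 5} from rfl]
  norm_num [bernoulli_two, bernoulli_three, bernoulli_four, bernoulli_five, bernoulli_six,
    bernoulli_eight, Nat.choose]
  ring

theorem corollary2p6 (q : ℕ) [NeZero q] (hq : 2 ≤ q) :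
    (∀ n : ℕ, 2 ≤ n → ¬ 2 ∣ n →
      meanValueL q 1 2 n 1 1 1 =
        (-1) ^ ((n + 1) / 2) * (2 * (Real.pi : ℂ)) ^ (n + 3) * (Nat.totient q : ℂ) ^ 2 /
            (8 * (q : ℂ) ^ (n + 3) * (Nat.factorial n : ℂ)) *
          ((sumN₁ q n - sumN₂ q n + sumN₃ q n : ℚ) : ℂ)) ∧
    meanValueL q 1 2 3 1 1 1 =
      (Real.pi : ℂ) ^ 6 * (Nat.totient q : ℂ) ^ 2 / (3780 * (q : ℂ) ^ 6) *
        ((jordanTotient 6 q - 21 * jordanTotient 2 q : ℚ) : ℂ) ∧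
    meanValueL q 1 2 5 1 1 1 =
      (Real.pi : ℂ) ^ 8 * (Nat.totient q : ℂ) ^ 2 / (37800 * (q : ℂ) ^ 8) *
        ((jordanTotient 8 q - 7 * jordanTotient 4 q - 50 * jordanTotient 2 q : ℚ) : ℂ) := by
  have hq0 : (q : ℂ) ≠ 0 := by exact_mod_cast NeZero.ne q
  refine ⟨fun n hn h2 ↦ meanValueL_one_two_odd q hq hn
    (Nat.not_even_iff_odd.1 fun he ↦ h2 he.two_dvd), ?_, ?_⟩
  · rw [meanValueL_one_two_odd q hq (by norm_num) (by decide), sumN_three]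
    norm_num [Nat.factorial]
    field_simp
    ring
  · rw [meanValueL_one_two_odd q hq (by norm_num) (by decide), sumN_five]
    norm_num [Nat.factorial]
    field_simp
    ring
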